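/- Consider $M$ users and $N$ options, in discrete time $t=1,2,\dots$, and let $1\le K\le N$. At time $t$ option $j$ would give user $i$ a reward $X^i_j(t)\in[0,1]$. For each $(i,j)$ the rewards are identically distributed over time with mean $\mu^i_j$, and the rewards at a time are independent of everything that happened before. For every user the means of different options are distinct, and all users order the options by mean reward in the same way (uniform preference). Let $N^i_K$ be the set of the $K$ options with the highest means for user $i$, $\overline N^i_K$ its complement, and $\Delta^i_j=\min_{l\in N^i_K}\mu^i_l-\mu^i_j$ for $j\in\overline N^i_K$. Let $a^i(t)$ be the set of options chosen by user $i$ at time $t$. Users announce their choices but not their rewards. Let $n^i_j(t)$ be the number of times user $i$ has chosen option $j$ in the steps $1,\dots,t$, let $r^i_j(t)$ be the average of the rewards user $i$ obtained from these choices, $n_j(t)=\sum_i n^i_j(t)$ and $\beta_j(t)=n_j(t)/\sum_l n_l(t)$. Fix a weight $\alpha\ge 0$. Under the algorithm U\_PART, each user $i$ chooses at each time $t+1$ exactly $K$ options whose indices $$r^i_j(t)-\alpha\,(1-\beta_j(t))\sqrt{\frac{\log t}{t}}+\sqrt{\frac{2\log t}{n^i_j(t)}}$$ are the $K$ highest,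 where the index is $+\infty$ if $n^i_j(t)=0$ and ties are broken in any way that does not use present or future rewards. The weak regret of user $i$ is $$R^i(t)=t\sum_{j\in N^i_K}\mu^i_j-\mathbb E\Big[\sum_{m=1}^{t}\sum_{j\in a^i(m)}X^i_j(m)\Big].$$ Then, if all users follow U\_PART, for every $\varepsilon>0$ there is a constant $C$, which depends only on $M$, $N$, $K$, the means $\mu^i_j$, $\alpha$ and $\varepsilon$, such that for every user $i$ and every $t\ge 1$ $$R^i(t)\le\sum_{j\in\overline N^i_K}\left\lceil\frac{(6+\varepsilon)\log t}{\Delta^i_j}\right\rceil+C.$$ -/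

import Mathlib

open MeasureTheory ProbabilityTheory

namespace GroupLearning

noncomputable section

/-- The set `N_K` of the `K` options with the highest mean rewards, for a vector `m` of (pairwise
distinct) means: the options that are beaten by fewer than `K` options. -/
def topOptions {N : ℕ} (K : ℕ) (m : Fin N → ℝ) : Finset (Fin N) :=
  {j | (Finset.univ.filter fun l => m j < m l).card < K}

/-- The gap `Δ_j` between the `K`-th highest mean and the mean of option `j`. -/
def gap {N : ℕ} (K : ℕ) (m : Fin N → ℝ) (j : Fin N) : ℝ :=
  sInf (m '' (topOptions K m : Set (Fin N))) - m j

/-- Different options have different mean rewards for every user, and all users order the options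
in the same way. -/
structure UniformPreference {M N : ℕ} (μ : Fin M → Fin N → ℝ) : Prop where
  distinct : ∀ i, Function.Injective (μ i)
  sameOrder : ∀ i k j₁ j₂, μ i j₂ < μ i j₁ → μ k j₂ < μ k j₁

section Counts

variable {M N : ℕ} {Ω : Type*}

/-- `n^i_j(t)`: the number of times user `i` has selected option `j` in the steps `1, …, t`. -/
def userCount (a : ℕ → Fin M → Ω → Finset (Fin N)) (t : ℕ) (i : Fin M) (j : Fin N) (ω : Ω) : ℕ :=
  ((Finset.Icc 1 t).filter fun m => j ∈ a m i ω).card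

/-- `n_j(t)`: the number of times option `j` has been selected by the whole group. -/
def groupCount (a : ℕ → Fin M → Ω → Finset (Fin N)) (t : ℕ) (j : Fin N) (ω : Ω) : ℕ :=
  ∑ i, userCount a t i j ω

/-- The group frequency `β_j(t) = n_j(t) / ∑ l, n_l(t)`. -/
def groupFreq (a : ℕ → Fin M → Ω → Finset (Fin N)) (t : ℕ) (j : Fin N) (ω : Ω) : ℝ :=
  (groupCount a t j ω : ℝ) / ∑ l, (groupCount a t l ω : ℝ)

/-- `r^i_j(t)`: the mean of the rewards that user `i` has itself collected from option `j`
in the steps `1, …, t`. -/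
def sampleMean (X : ℕ → Fin M → Fin N → Ω → ℝ) (a : ℕ → Fin M → Ω → Finset (Fin N))
    (t : ℕ) (i : Fin M) (j : Fin N) (ω : Ω) : ℝ :=
  (∑ m ∈ (Finset.Icc 1 t).filter (fun m => j ∈ a m i ω), X m i j ω) / userCount a t i j ω

/-- The U_PART index of option `j` for user `i`, computed from the rewards of user `i` and the
choices of all users in the steps `1, …, t`. An option which user `i` has not yet tried has
index `+∞`. -/
def upartIndex (α : ℝ) (X : ℕ → Fin M → Fin N → Ω → ℝ) (a : ℕ → Fin M → Ω → Finset (Fin N))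
    (t : ℕ) (i : Fin M) (j : Fin N) (ω : Ω) : EReal :=
  if userCount a t i j ω = 0 then ⊤
  else ((sampleMean X a t i j ω
      - α * (1 - groupFreq a t j ω) * √(Real.log t / t)
      + √(2 * Real.log t / userCount a t i j ω) : ℝ) : EReal)

end Counts

section Model

variable {M N : ℕ} {Ω : Type*} [mΩ : MeasurableSpace Ω]

/-- `X t i j` is the reward of option `j` for user `i` at time `t = 1, 2, …`. For each user and
option the rewards are identically distributed over time, take values in `[0, 1]` and have mean
`μ i j`; all rewards at a time are independent of the past. The filtration `ℱ t` is the information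
available after step `t` (past rewards, and possibly randomization used to break ties).
Nothing is assumed about the joint law of the rewards of different users or options
at the same time. -/
structure IsRewardProcess (P : Measure Ω) (ℱ : Filtration ℕ mΩ) (μ : Fin M → Fin N → ℝ)
    (X : ℕ → Fin M → Fin N → Ω → ℝ) : Prop where
  adapted : ∀ t, 1 ≤ t → ∀ i j, Measurable[ℱ t] (X t i j)
  indep_past : ∀ t, Indep
    (MeasurableSpace.comap (fun ω (i : Fin M) (j : Fin N) => X (t + 1) i j ω) inferInstance)
    (ℱ t) P
  identDistrib : ∀ s t, 1 ≤ s → 1 ≤ t → ∀ i j, IdentDistrib (X s i j) (X t i j) P P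
  mem_unit : ∀ t, 1 ≤ t → ∀ i j, ∀ᵐ ω ∂P, X t i j ω ∈ Set.Icc (0 : ℝ) 1
  mean : ∀ t, 1 ≤ t → ∀ i j, ∫ ω, X t i j ω ∂P = μ i j

/-- `a t i` is the set of options chosen by user `i` at time `t = 1, 2, …`, when all users follow
U_PART with weight `α`: at step `t + 1` every user selects `K` options whose indices, computed from
the observations of the steps `1, …, t`, are the `K` highest. Ties are broken arbitrarily,
without looking into the future. -/
structure IsUPart (ℱ : Filtration ℕ mΩ) (K : ℕ) (α : ℝ)
    (X : ℕ → Fin M → Fin N → Ω → ℝ) (a : ℕ → Fin M → Ω → Finset (Fin N)) : Prop where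
  predictable : ∀ t i j, MeasurableSet[ℱ t] {ω | j ∈ a (t + 1) i ω}
  card_eq : ∀ t i ω, (a (t + 1) i ω).card = K
  highest : ∀ t i ω, ∀ j ∈ a (t + 1) i ω, ∀ l ∉ a (t + 1) i ω,
    upartIndex α X a t i l ω ≤ upartIndex α X a t i j ω

/-- The weak regret of user `i` up to time `T`. -/
def weakRegret (P : Measure Ω) (K : ℕ) (μ : Fin M → Fin N → ℝ)
    (X : ℕ → Fin M → Fin N → Ω → ℝ) (a : ℕ → Fin M → Ω → Finset (Fin N))
    (i : Fin M) (T : ℕ) : ℝ :=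
  T * ∑ j ∈ topOptions K (μ i), μ i j
    - ∫ ω, ∑ t ∈ Finset.Icc 1 T, ∑ j ∈ a t i ω, X t i j ω ∂P

end Model

end

end GroupLearning

/-! If a user picks `j` outside the top set, some top option `l` is left out, so the choice can be
charged swap by swap with `D = μ l - μ j`. This may exceed the gap `g` of `j`, so counting pulls and
multiplying by `g` is not enough. But the confidence radius that lets `j` beat `l` also bounds `D`.
Suppose the time is late enough that the penalty `α √(log t / t)` is at most `g / 20`, the sample
mean of `j` is less than `g / 20` too high, and `l` lies below the top of its confidence interval.
Comparing indices then gives `D ≤ g / 10 + √(2 log t / n)`, with `n` the earlier pulls of `j`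
(`le_pullCost_of_index_le`). Since `g ≤ D`, both `D ≤ (10/9) √(2 log t / n)` and `n = O(log t / g²)`
follow; summing `1 / √n` over these pulls costs `(400/81) log t / g` plus a constant
(`sum_pullCost_le`), and `400/81 < 6`. The group frequency enters only through `0 ≤ β ≤ 1`.

The exceptional steps cost at most 1 each and are boundedly many in expectation. Both estimates come
from the weights `exp (c S - θ n)`: overestimates of `j` are counted only at pulls of `j`
(`IsArm.sum_prob_upper_deviation`), and failures of the confidence bound of `l` have probability at
most `t⁻³` (`IsArm.prob_lower_radius`). -/

namespace GroupLearning

noncomputable section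

/-! ### Concentration for one adaptively sampled arm -/

section SingleArm

variable {Ω : Type*}

/-- The number of indices `m < t` for which `B m` occurs. -/
def armCount (B : ℕ → Set Ω) (t : ℕ) (ω : Ω) : ℝ :=
  ∑ m ∈ Finset.range t, (B m).indicator 1 ω

/-- The sum of `Y m` over the indices `m < t` for which `B m` occurs. -/
def armSum (B : ℕ → Set Ω) (Y : ℕ → Ω → ℝ) (t : ℕ) (ω : Ω) : ℝ :=
  ∑ m ∈ Finset.range t, (B m).indicator (Y m) ω

/-- The exponential weight `exp (c S_t - θ n_t)` of an arm. -/
def armWeight (B : ℕ → Set Ω) (Y : ℕ → Ω → ℝ) (c θ : ℝ) (t : ℕ) (ω : Ω) : ℝ :=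
  Real.exp (c * armSum B Y t ω - θ * armCount B t ω)

theorem armSum_neg (B : ℕ → Set Ω) (Y : ℕ → Ω → ℝ) (t : ℕ) (ω : Ω) :
    armSum B (fun t ω => -Y t ω) t ω = -armSum B Y t ω := by
  simp only [armSum, ← Finset.sum_neg_distrib]
  refine Finset.sum_congr rfl fun m _ => ?_
  by_cases h : ω ∈ B m <;> simp [h]

/-- On a pull the new weight splits into a factor known from the past and `exp (c Y)`, which is the
form needed to apply independence. -/
theorem armWeight_succ (B : ℕ → Set Ω) (Y : ℕ → Ω → ℝ) (c θ : ℝ) (t : ℕ) (ω : Ω) :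
    armWeight B Y c θ (t + 1) ω = (B t)ᶜ.indicator (armWeight B Y c θ t) ω
      + Real.exp (-θ) * ((B t).indicator (armWeight B Y c θ t) ω * Real.exp (c * Y t ω)) := by
  by_cases hB : ω ∈ B t
  · simp only [armWeight, armSum, armCount, Finset.sum_range_succ, hB, Set.indicator_of_mem,
      Set.mem_compl_iff, not_true, not_false_eq_true, Set.indicator_of_notMem, ← Real.exp_add,
      Pi.one_apply, zero_add]
    congr 1; ring
  · simp [armWeight, armSum, armCount, Finset.sum_range_succ, hB]

theorem armCount_eq_natCast (B : ℕ → Set Ω) (t : ℕ) (ω : Ω) :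
    ∃ n : ℕ, n ≤ t ∧ armCount B t ω = n := by
  classical
  refine ⟨((Finset.range t).filter fun m => ω ∈ B m).card, ?_, ?_⟩
  · exact (Finset.card_filter_le _ _).trans (by simp)
  · simp [armCount, Set.indicator_apply]

variable [mΩ : MeasurableSpace Ω]

/-- The arm is pulled at step `t` on the event `B t`, which is known before the step; the centred
reward `Y t` of the step is independent of the past and sub-Gaussian with variance proxy `1 / 4`. -/
structure IsArm (P : Measure Ω) (ℱ : Filtration ℕ mΩ) (B : ℕ → Set Ω) (Y : ℕ → Ω → ℝ) : Prop where
  pull : ∀ t, MeasurableSet[ℱ t] (B t)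
  adapted : ∀ t, Measurable[ℱ (t + 1)] (Y t)
  indep : ∀ t, Indep (MeasurableSpace.comap (Y t) inferInstance) (ℱ t) P
  subgaussian : ∀ t, HasSubgaussianMGF (Y t) (1 / 4) P

theorem IsArm.neg {P : Measure Ω} {ℱ : Filtration ℕ mΩ} {B : ℕ → Set Ω} {Y : ℕ → Ω → ℝ}
    (h : IsArm P ℱ B Y) : IsArm P ℱ B (fun t ω => -Y t ω) where
  pull := h.pull
  adapted t := (h.adapted t).neg
  indep t := by
    refine indep_of_indep_of_le_left (h.indep t) ?_
    have : Measurable[MeasurableSpace.comap (Y t) inferInstance] (fun ω => -Y t ω) :=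
      (comap_measurable (Y t)).neg
    exact this.comap_le
  subgaussian t := (h.subgaussian t).neg

variable {P : Measure Ω} {ℱ : Filtration ℕ mΩ} {B : ℕ → Set Ω} {Y : ℕ → Ω → ℝ}

theorem IsArm.measurable_armCount (h : IsArm P ℱ B Y) (t : ℕ) :
    Measurable[ℱ t] (armCount B t) := by
  unfold armCount
  refine Finset.measurable_sum _ fun m hm => ?_
  have hle : ℱ m ≤ ℱ t := ℱ.mono (Finset.mem_range.1 hm).le
  exact Measurable.indicator measurable_const (hle _ (h.pull m))

theorem IsArm.measurable_armSum (h : IsArm P ℱ B Y) (t : ℕ) :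
    Measurable[ℱ t] (armSum B Y t) := by
  unfold armSum
  refine Finset.measurable_sum _ fun m hm => ?_
  have hle : ℱ m ≤ ℱ t := ℱ.mono (Finset.mem_range.1 hm).le
  have hle' : ℱ (m + 1) ≤ ℱ t := ℱ.mono (Finset.mem_range.1 hm)
  exact ((h.adapted m).mono hle' le_rfl).indicator (hle _ (h.pull m))

theorem IsArm.measurable_armWeight (h : IsArm P ℱ B Y) (c θ : ℝ) (t : ℕ) :
    Measurable[ℱ t] (armWeight B Y c θ t) :=
  Real.measurable_exp.comp
    (((h.measurable_armSum t).const_mul c).sub ((h.measurable_armCount t).const_mul θ))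

/-- One step of the exponential weight. -/
theorem IsArm.armWeight_step [IsProbabilityMeasure P] (h : IsArm P ℱ B Y) (c θ : ℝ) (t : ℕ)
    (hint : Integrable (armWeight B Y c θ t) P) :
    Integrable (armWeight B Y c θ (t + 1)) P ∧
      ∫ ω, armWeight B Y c θ (t + 1) ω ∂P
        + (1 - Real.exp (c ^ 2 / 8 - θ)) * ∫ ω, (B t).indicator (armWeight B Y c θ t) ω ∂P
        ≤ ∫ ω, armWeight B Y c θ t ω ∂P := by
  have hBm : MeasurableSet (B t) := ℱ.le t _ (h.pull t)
  set W := armWeight B Y c θ t with hW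
  have hWB : Integrable ((B t).indicator W) P := hint.indicator hBm
  have hWc : Integrable ((B t)ᶜ.indicator W) P := hint.indicator hBm.compl
  have hE : Integrable (fun ω => Real.exp (c * Y t ω)) P := (h.subgaussian t).integrable_exp_mul c
  have hind : IndepFun ((B t).indicator W) (fun ω => Real.exp (c * Y t ω)) P := by
    rw [IndepFun_iff_Indep]
    refine (indep_of_indep_of_le_left (indep_of_indep_of_le_right (h.indep t) ?_) ?_).symm
    · exact ((h.measurable_armWeight c θ t).indicator (h.pull t)).comap_le
    · have : Measurable[MeasurableSpace.comap (Y t) inferInstance]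
          (fun ω => Real.exp (c * Y t ω)) :=
        Real.measurable_exp.comp ((comap_measurable (Y t)).const_mul c)
      exact this.comap_le
  have hprod : Integrable (fun ω => (B t).indicator W ω * Real.exp (c * Y t ω)) P :=
    hind.integrable_mul hWB hE
  have heq : armWeight B Y c θ (t + 1) = fun ω => (B t)ᶜ.indicator W ω
      + Real.exp (-θ) * ((B t).indicator W ω * Real.exp (c * Y t ω)) :=
    funext fun ω => armWeight_succ B Y c θ t ω
  refine ⟨heq ▸ hWc.add (hprod.const_mul _), ?_⟩
  have hmgf : ∫ ω, Real.exp (c * Y t ω) ∂P ≤ Real.exp (c ^ 2 / 8) := by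
    refine ((h.subgaussian t).mgf_le c).trans (le_of_eq ?_)
    congr 1; push_cast; ring
  have hI0 : 0 ≤ ∫ ω, (B t).indicator W ω ∂P :=
    integral_nonneg fun ω => Set.indicator_nonneg (fun _ _ => (Real.exp_pos _).le) ω
  have hsplit : ∫ ω, W ω ∂P = ∫ ω, (B t).indicator W ω ∂P + ∫ ω, (B t)ᶜ.indicator W ω ∂P := by
    rw [← integral_add hWB hWc]
    exact integral_congr_ae (.of_forall fun ω => (Set.indicator_self_add_compl_apply _ _ _).symm)
  rw [heq, integral_add hWc (hprod.const_mul _), integral_const_mul,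
    hind.integral_fun_mul_eq_mul_integral hWB.aestronglyMeasurable hE.aestronglyMeasurable, hsplit]
  have : Real.exp (-θ) * ((∫ ω, (B t).indicator W ω ∂P) * ∫ ω, Real.exp (c * Y t ω) ∂P)
      ≤ Real.exp (c ^ 2 / 8 - θ) * ∫ ω, (B t).indicator W ω ∂P := by
    rw [sub_eq_add_neg, Real.exp_add]
    have := mul_le_mul_of_nonneg_left hmgf (mul_nonneg (Real.exp_pos (-θ)).le hI0)
    linarith
  linarith

/-- Telescoping the one-step bound while keeping the loss at each pull. With `θ = c² / 8` the loss
vanishes and the weight is a supermartingale; with larger `θ` the loss bounds the total weight seen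
at pulls. -/
theorem IsArm.integral_armWeight [IsProbabilityMeasure P] (h : IsArm P ℱ B Y) (c θ : ℝ) (t : ℕ) :
    Integrable (armWeight B Y c θ t) P ∧
      ∫ ω, armWeight B Y c θ t ω ∂P + (1 - Real.exp (c ^ 2 / 8 - θ)) *
        ∑ m ∈ Finset.range t, ∫ ω, (B m).indicator (armWeight B Y c θ m) ω ∂P ≤ 1 := by
  induction t with
  | zero =>
    have : armWeight B Y c θ 0 = fun _ => 1 := by
      funext ω; simp [armWeight, armSum, armCount]
    simp [this]
  | succ t ih =>
    obtain ⟨h1, h2⟩ := h.armWeight_step c θ t ih.1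
    refine ⟨h1, ?_⟩
    rw [Finset.sum_range_succ, mul_add]
    linarith [ih.2]

/-- The expected number of pulls at which the sample mean is too high by `δ` is bounded. -/
theorem IsArm.sum_prob_upper_deviation [IsProbabilityMeasure P] (h : IsArm P ℱ B Y) {δ : ℝ}
    (hδ : 0 < δ) (t : ℕ) :
    ∑ m ∈ Finset.range t, P.real {ω | ω ∈ B m ∧ δ * armCount B m ω ≤ armSum B Y m ω}
      ≤ 1 / (1 - Real.exp (-2 * δ ^ 2)) := by
  have hexp : Real.exp (-2 * δ ^ 2) < 1 := by
    rw [Real.exp_lt_one_iff]; nlinarith [pow_pos hδ 2]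
  -- With `c = 4δ` and `θ = 4δ²` the weight is at least 1 on the event, while `c² / 8 - θ = -2δ²` is
  -- negative.
  have hle : ∀ m, P.real {ω | ω ∈ B m ∧ δ * armCount B m ω ≤ armSum B Y m ω}
      ≤ ∫ ω, (B m).indicator (armWeight B Y (4 * δ) (4 * δ ^ 2) m) ω ∂P := by
    intro m
    have hm : MeasurableSet (B m) := ℱ.le m _ (h.pull m)
    have hS := (h.measurable_armSum m).mono (ℱ.le m) le_rfl
    have hN := (h.measurable_armCount m).mono (ℱ.le m) le_rfl
    have hms : MeasurableSet {ω | ω ∈ B m ∧ δ * armCount B m ω ≤ armSum B Y m ω} :=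
      hm.inter (measurableSet_le (hN.const_mul δ) hS)
    rw [← integral_indicator_one hms]
    refine integral_mono ((integrable_const 1).indicator hms)
      ((h.integral_armWeight _ _ m).1.indicator hm) fun ω => ?_
    by_cases hω : ω ∈ {ω | ω ∈ B m ∧ δ * armCount B m ω ≤ armSum B Y m ω}
    · rw [Set.indicator_of_mem hω, Set.indicator_of_mem hω.1]
      refine Real.one_le_exp ?_
      nlinarith [hω.2, mul_le_mul_of_nonneg_left hω.2 hδ.le]
    · rw [Set.indicator_of_notMem hω]
      exact Set.indicator_nonneg (fun _ _ => (Real.exp_pos _).le) ω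
  have hmain := (h.integral_armWeight (4 * δ) (4 * δ ^ 2) t).2
  have h0 : 0 ≤ ∫ ω, armWeight B Y (4 * δ) (4 * δ ^ 2) t ω ∂P :=
    integral_nonneg fun ω => (Real.exp_pos _).le
  have hc : (4 * δ) ^ 2 / 8 - 4 * δ ^ 2 = -2 * δ ^ 2 := by ring
  rw [hc] at hmain
  rw [le_div_iff₀ (by linarith), mul_comm]
  refine le_trans (mul_le_mul_of_nonneg_left (Finset.sum_le_sum fun m _ => hle m) (by linarith)) ?_
  linarith

/-- Hoeffding's bound despite adaptive sampling: Markov's inequality for the weight with `θ = c² /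
8`, where `c = 4x / n` maximizes `c x - c² n / 8`. -/
theorem IsArm.prob_upper_of_count [IsProbabilityMeasure P] (h : IsArm P ℱ B Y) {x n : ℝ}
    (hn : 0 < n) (hx : 0 ≤ x) (t : ℕ) :
    P.real {ω | armCount B t ω = n ∧ x ≤ armSum B Y t ω} ≤ Real.exp (-2 * x ^ 2 / n) := by
  set c := 4 * x / n with hc
  have hmain := (h.integral_armWeight c (c ^ 2 / 8) t).2
  have hi := (h.integral_armWeight c (c ^ 2 / 8) t).1
  simp only [sub_self, Real.exp_zero, zero_mul, add_zero] at hmain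
  have hmarkov := mul_meas_ge_le_integral_of_nonneg
    (.of_forall fun ω => (Real.exp_pos _).le) hi (Real.exp (2 * x ^ 2 / n))
  have hsub : {ω | armCount B t ω = n ∧ x ≤ armSum B Y t ω}
      ⊆ {ω | Real.exp (2 * x ^ 2 / n) ≤ armWeight B Y c (c ^ 2 / 8) t ω} := by
    rintro ω ⟨h1, h2⟩
    refine Real.exp_le_exp.2 ?_
    rw [h1]
    have hc0 : 0 ≤ c := by positivity
    have := mul_le_mul_of_nonneg_left h2 hc0
    have e : c * x - c ^ 2 / 8 * n = 2 * x ^ 2 / n := by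
      rw [hc]; field_simp; ring
    linarith
  have hmono := measureReal_mono (μ := P) hsub
  have e2 : Real.exp (-2 * x ^ 2 / n) = (Real.exp (2 * x ^ 2 / n))⁻¹ := by
    rw [← Real.exp_neg]; congr 1; ring
  rw [e2, ← one_div, le_div_iff₀ (Real.exp_pos _), mul_comm]
  refine le_trans (mul_le_mul_of_nonneg_left hmono (Real.exp_pos _).le) ?_
  exact hmarkov.trans hmain

/-- The sample mean exceeds the upper confidence radius `√(2 log t / n)` with probability at most
`t⁻³`. -/
theorem IsArm.prob_upper_radius [IsProbabilityMeasure P] (h : IsArm P ℱ B Y) {t : ℕ} :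
    P.real {ω | 0 < armCount B t ω ∧ √(2 * armCount B t ω * Real.log t) ≤ armSum B Y t ω}
      ≤ 1 / (t : ℝ) ^ 3 := by
  rcases Nat.eq_zero_or_pos t with rfl | ht
  · simp [armCount]
  -- The count is random, so a union over its `t` possible positive values, each contributing `t⁻⁴`.
  have hsub : {ω | 0 < armCount B t ω ∧ √(2 * armCount B t ω * Real.log t) ≤ armSum B Y t ω}
      ⊆ ⋃ n ∈ Finset.Icc 1 t,
        {ω | armCount B t ω = (n : ℕ) ∧ √(2 * n * Real.log t) ≤ armSum B Y t ω} := by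
    rintro ω ⟨h1, h2⟩
    obtain ⟨n, hn, hc⟩ := armCount_eq_natCast B t ω
    rw [hc] at h1 h2
    simp only [Set.mem_iUnion, Finset.mem_Icc]
    exact ⟨n, ⟨by exact_mod_cast h1, hn⟩, hc, h2⟩
  refine (measureReal_mono hsub (measure_ne_top _ _)).trans
    ((measureReal_biUnion_finset_le _ _).trans ?_)
  have hbd : ∀ n ∈ Finset.Icc 1 t,
      P.real {ω | armCount B t ω = (n : ℕ) ∧ √(2 * n * Real.log t) ≤ armSum B Y t ω}
        ≤ 1 / (t : ℝ) ^ 4 := by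
    intro n hn
    have hn0 : (0 : ℝ) < n := by exact_mod_cast (Finset.mem_Icc.1 hn).1
    have ht0 : (0 : ℝ) < t := by exact_mod_cast ht
    have hlog : 0 ≤ Real.log t := Real.log_natCast_nonneg t
    refine (h.prob_upper_of_count hn0 (Real.sqrt_nonneg _) t).trans (le_of_eq ?_)
    rw [Real.sq_sqrt (by positivity)]
    have : -2 * (2 * (n : ℝ) * Real.log t) / n = -(((4 : ℕ) : ℝ) * Real.log t) := by
      field_simp; ring
    rw [this, Real.exp_neg, Real.exp_nat_mul, Real.exp_log ht0, one_div]
  refine (Finset.sum_le_sum hbd).trans (le_of_eq ?_)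
  have ht0 : (t : ℝ) ≠ 0 := by exact_mod_cast ht.ne'
  simp only [Finset.sum_const, Nat.card_Icc, nsmul_eq_mul, Nat.add_sub_cancel]
  field_simp

theorem IsArm.prob_lower_radius [IsProbabilityMeasure P] (h : IsArm P ℱ B Y) {t : ℕ} :
    P.real {ω | 0 < armCount B t ω ∧ armSum B Y t ω ≤ -√(2 * armCount B t ω * Real.log t)}
      ≤ 1 / (t : ℝ) ^ 3 := by
  have := h.neg.prob_upper_radius (t := t)
  simpa only [armSum_neg, le_neg] using this

end SingleArm

/-! ### The top options and exchanges between sets of equal size -/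

section TopOptions

variable {N K : ℕ} {m : Fin N → ℝ}

/-- The rank, i.e. the number of better options, is a bijection onto `{0, …, N - 1}` because the
means are distinct; the top options are those of rank below `K`. -/
theorem card_topOptions (hm : Function.Injective m) (hKN : K ≤ N) :
    (topOptions K m).card = K := by
  set r : Fin N → ℕ := fun j => (Finset.univ.filter fun l => m j < m l).card with hr
  have hlt : ∀ {j l}, m j < m l → r l < r j := by
    intro j l hjl
    refine Finset.card_lt_card (Finset.ssubset_iff_of_subset ?_ |>.2 ⟨l, ?_, ?_⟩)
    · intro x hx
      simp only [Finset.mem_filter, Finset.mem_univ, true_and] at hx ⊢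
      exact hjl.trans hx
    · simpa using hjl
    · simp
  have hinj : Function.Injective r := by
    intro j l hjl
    rcases lt_trichotomy (m j) (m l) with h | h | h
    · exact absurd hjl (hlt h).ne'
    · exact hm h
    · exact absurd hjl (hlt h).ne
  have himg : Finset.univ.image r = Finset.range N := by
    refine Finset.eq_of_subset_of_card_le ?_ ?_
    · intro x hx
      obtain ⟨j, -, rfl⟩ := Finset.mem_image.1 hx
      rw [Finset.mem_range]
      refine lt_of_lt_of_eq (Finset.card_lt_card (Finset.filter_ssubset.2 ⟨j, ?_, ?_⟩)) (by simp)
      · simp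
      · simp
    · rw [Finset.card_image_of_injective _ hinj]; simp
  have htop : (topOptions K m).image r = Finset.range K := by
    ext x
    simp only [topOptions, Finset.mem_image, Finset.mem_filter, Finset.mem_univ, true_and,
      Finset.mem_range]
    constructor
    · rintro ⟨j, hj, rfl⟩; exact hj
    · intro hx
      have : x ∈ Finset.univ.image r := himg ▸ Finset.mem_range.2 (hx.trans_le hKN)
      obtain ⟨j, -, rfl⟩ := Finset.mem_image.1 this
      exact ⟨j, hx, rfl⟩
  rw [← Finset.card_image_of_injective _ hinj, htop, Finset.card_range]

theorem lt_of_mem_topOptions {j l : Fin N} (hl : l ∈ topOptions K m) (hj : j ∉ topOptions K m) :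
    m j < m l := by
  by_contra! h
  refine hj ?_
  simp only [topOptions, Finset.mem_filter, Finset.mem_univ, true_and] at hl ⊢
  refine lt_of_le_of_lt (Finset.card_le_card ?_) hl
  intro x hx
  simp only [Finset.mem_filter, Finset.mem_univ, true_and] at hx ⊢
  exact h.trans_lt hx

theorem gap_le {j l : Fin N} (hl : l ∈ topOptions K m) : gap K m j ≤ m l - m j :=
  sub_le_sub_right (csInf_le ((Set.toFinite _).bddBelow) (Set.mem_image_of_mem _ hl)) _

theorem gap_pos (hm : Function.Injective m) (hK : 1 ≤ K) (hKN : K ≤ N) {j : Fin N}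
    (hj : j ∉ topOptions K m) : 0 < gap K m j := by
  have hne : (topOptions K m).Nonempty := by
    rw [← Finset.card_pos, card_topOptions hm hKN]; exact hK
  have hmem : sInf (m '' (topOptions K m : Set (Fin N))) ∈ m '' (topOptions K m : Set (Fin N)) :=
    Set.Nonempty.csInf_mem (hne.to_set.image m) (Set.toFinite _)
  obtain ⟨l, hl, hle⟩ := hmem
  rw [gap, ← hle]
  exact sub_pos.2 (lt_of_mem_topOptions hl hj)

/-- If two sets have the same size and every swap of an element of `s \ t` for an element of `t \ s`
gains at most `c j`, then so does the exchange of `s` for `t`. -/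
theorem sum_sub_sum_le_of_swap {ι : Type*} [DecidableEq ι] {s t : Finset ι}
    (hcard : s.card = t.card) (f c : ι → ℝ) (h : ∀ j ∈ s \ t, ∀ l ∈ t \ s, f l - f j ≤ c j) :
    ∑ l ∈ t, f l - ∑ j ∈ s, f j ≤ ∑ j ∈ s \ t, c j := by
  have hc : (s \ t).card = (t \ s).card := Finset.card_sdiff_comm hcard
  rw [← Finset.sum_sdiff_sub_sum_sdiff]
  rcases (t \ s).eq_empty_or_nonempty with he | hne
  · have : s \ t = ∅ := by rw [← Finset.card_eq_zero, hc, he, Finset.card_empty]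
    simp [he, this]
  -- No explicit matching is needed: every element of `t \ s` is replaced by the best one.
  · obtain ⟨l, hl, hmax⟩ := Finset.exists_max_image (t \ s) f hne
    have h1 : ∑ x ∈ t \ s, f x ≤ ∑ _j ∈ s \ t, f l := by
      refine (Finset.sum_le_card_nsmul _ _ _ hmax).trans (le_of_eq ?_)
      rw [Finset.sum_const, hc]
    refine (sub_le_sub_right h1 _).trans ?_
    rw [← Finset.sum_sub_distrib]
    exact Finset.sum_le_sum fun j hj => h j hj l hl

end TopOptions

/-! ### Total cost of the pulls of one option -/

section PullCost

/-- A bound for the cost of a pull of an option of gap `g` that has been pulled `n` times before,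
while its sample mean is accurate, when `L` bounds the logarithm of the time. -/
def pullCost (L g : ℝ) (n : ℕ) : ℝ :=
  if n = 0 then 1
  else if (n : ℝ) ≤ (10 / 9 * √(2 * L) / g) ^ 2 then 10 / 9 * √(2 * L / n) else 0

theorem pullCost_nonneg (L g : ℝ) (n : ℕ) : 0 ≤ pullCost L g n := by
  unfold pullCost; split_ifs <;> positivity

theorem sum_Icc_inv_sqrt_le (n : ℕ) : ∑ k ∈ Finset.Icc 1 n, 1 / √(k : ℝ) ≤ 2 * √(n : ℝ) := by
  induction n with
  | zero => simp
  | succ n ih =>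
    rw [Finset.sum_Icc_succ_top (by omega)]
    set x := √(n : ℝ)
    set y := √((n + 1 : ℕ) : ℝ) with hy
    have hx0 : 0 ≤ x := Real.sqrt_nonneg _
    have hy0 : 0 < y := Real.sqrt_pos.2 (by positivity)
    have hxx : x ^ 2 = n := Real.sq_sqrt (by positivity)
    have hyy : y ^ 2 = n + 1 := by rw [hy, Real.sq_sqrt (by positivity)]; push_cast; ring
    have : 1 / y ≤ 2 * (y - x) := by
      rw [div_le_iff₀ hy0]; nlinarith [sq_nonneg (y - x)]
    linarith

/-- The first pull costs 1. The others sum to at most `(10/9) √(2L) · 2v`, where `v = (10/9) √(2L) /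
g` is the square root of the cutoff; this equals `(400/81) L / g`. -/
theorem sum_pullCost_le {L g : ℝ} (hL : 0 ≤ L) (hg : 0 < g) (n : ℕ) :
    ∑ k ∈ Finset.range n, pullCost L g k ≤ 1 + 400 / 81 * L / g := by
  set v := 10 / 9 * √(2 * L) / g with hv
  have hv0 : 0 ≤ v := by positivity
  set u := ⌊v ^ 2⌋₊ with hu
  have hsub : ∀ k ∈ Finset.range n, pullCost L g k ≤
      (if k = 0 then 1 else 0)
        + if k ∈ Finset.Icc 1 u then 10 / 9 * √(2 * L) * (1 / √(k : ℝ)) else 0 := by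
    intro k _
    unfold pullCost
    rcases Nat.eq_zero_or_pos k with rfl | hk
    · simp
    · rw [if_neg hk.ne', if_neg hk.ne', zero_add]
      have hiff : (k : ℝ) ≤ v ^ 2 ↔ k ∈ Finset.Icc 1 u := by
        rw [Finset.mem_Icc, hu, Nat.le_floor_iff (by positivity)]
        exact ⟨fun h => ⟨hk, h⟩, fun h => h.2⟩
      by_cases h : (k : ℝ) ≤ v ^ 2
      · rw [if_pos h, if_pos (hiff.1 h), Real.sqrt_div (by positivity)]
        exact le_of_eq (by ring)
      · rw [if_neg h, if_neg (mt hiff.2 h)]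
  refine (Finset.sum_le_sum hsub).trans ?_
  rw [Finset.sum_add_distrib]
  refine add_le_add ?_ ?_
  · rw [Finset.sum_ite_eq' (Finset.range n) 0 (fun _ => (1 : ℝ))]
    split_ifs <;> norm_num
  · rw [← Finset.sum_filter]
    have h1 : ∑ k ∈ (Finset.range n).filter (· ∈ Finset.Icc 1 u), 10 / 9 * √(2 * L) * (1 / √(k : ℝ))
        ≤ ∑ k ∈ Finset.Icc 1 u, 10 / 9 * √(2 * L) * (1 / √(k : ℝ)) := by
      refine Finset.sum_le_sum_of_subset_of_nonneg ?_ fun _ _ _ => by positivity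
      intro k hk; exact (Finset.mem_filter.1 hk).2
    refine h1.trans ?_
    rw [← Finset.mul_sum]
    have h2 : √(u : ℝ) ≤ v := Real.sqrt_le_iff.2 ⟨hv0, Nat.floor_le (by positivity)⟩
    have h3 := (sum_Icc_inv_sqrt_le u).trans (mul_le_mul_of_nonneg_left h2 zero_le_two)
    refine (mul_le_mul_of_nonneg_left h3 (by positivity)).trans (le_of_eq ?_)
    have h4 : √(2 * L) * √(2 * L) = 2 * L := Real.mul_self_sqrt (by positivity)
    rw [hv]
    calc 10 / 9 * √(2 * L) * (2 * (10 / 9 * √(2 * L) / g))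
        = 200 / 81 * (√(2 * L) * √(2 * L)) / g := by ring
      _ = _ := by rw [h4]; ring

/-- A cost `D` which is at most a tenth of the gap plus a confidence radius is at most `pullCost`. -/
theorem le_pullCost {L g D : ℝ} (hg : 0 < g) (hgD : g ≤ D) {n : ℕ} (hn : n ≠ 0)
    (h : D ≤ g / 10 + √(2 * L / n)) : D ≤ pullCost L g n := by
  have hn0 : (0 : ℝ) < n := by positivity
  -- Since `g ≤ D`, the term `g / 10` is absorbed into `D / 10`.
  have hD : D ≤ 10 / 9 * √(2 * L / n) := by linarith
  have hcut : (n : ℝ) ≤ (10 / 9 * √(2 * L) / g) ^ 2 := by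
    have h1 : g ≤ 10 / 9 * √(2 * L) / √(n : ℝ) := by
      rw [Real.sqrt_div' _ hn0.le] at hD
      exact (hgD.trans hD).trans_eq (by ring)
    have hs : 0 < √(n : ℝ) := Real.sqrt_pos.2 hn0
    have h2 : √(n : ℝ) ≤ 10 / 9 * √(2 * L) / g := by
      rw [le_div_iff₀ hs] at h1
      rw [le_div_iff₀ hg]; linarith
    exact (Real.sqrt_le_left (by positivity)).1 h2
  rw [pullCost, if_neg hn, if_pos hcut]
  exact hD

end PullCost

/-! ### Counts, sample means and the comparison of indices -/

section Counts

variable {M N : ℕ} {Ω : Type*}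

/-- The event that user `i` selects option `j` in the step after time `t`. -/
def pullEvent (a : ℕ → Fin M → Ω → Finset (Fin N)) (i : Fin M) (j : Fin N) (t : ℕ) : Set Ω :=
  {ω | j ∈ a (t + 1) i ω}

/-- The centred reward of option `j` for user `i` in the step after time `t`. -/
def centredReward (X : ℕ → Fin M → Fin N → Ω → ℝ) (μ : Fin M → Fin N → ℝ) (i : Fin M) (j : Fin N)
    (t : ℕ) (ω : Ω) : ℝ :=
  X (t + 1) i j ω - μ i j

variable (X : ℕ → Fin M → Fin N → Ω → ℝ) (a : ℕ → Fin M → Ω → Finset (Fin N))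
  (μ : Fin M → Fin N → ℝ) (i : Fin M) (j : Fin N) (t : ℕ) (ω : Ω)

theorem userCount_succ :
    userCount a (t + 1) i j ω = userCount a t i j ω + if j ∈ a (t + 1) i ω then 1 else 0 := by
  simp only [userCount, Finset.card_filter]
  rw [Finset.sum_Icc_succ_top (by omega)]

theorem armCount_pullEvent : armCount (pullEvent a i j) t ω = userCount a t i j ω := by
  induction t with
  | zero => simp [armCount, userCount]
  | succ t ih =>
    rw [userCount_succ, armCount, Finset.sum_range_succ, ← armCount, ih]
    by_cases h : j ∈ a (t + 1) i ω <;> simp [pullEvent, h]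

theorem sum_reward_eq : ∑ m ∈ (Finset.Icc 1 t).filter (fun m => j ∈ a m i ω), X m i j ω
    = armSum (pullEvent a i j) (centredReward X μ i j) t ω + μ i j * userCount a t i j ω := by
  induction t with
  | zero => simp [armSum, userCount]
  | succ t ih =>
    rw [Finset.sum_filter] at ih ⊢
    rw [Finset.sum_Icc_succ_top (by omega), ih, userCount_succ, armSum, armSum,
      Finset.sum_range_succ]
    by_cases h : j ∈ a (t + 1) i ω
    · simp [pullEvent, centredReward, h]; ring
    · simp [pullEvent, h]

theorem sampleMean_eq (h : userCount a t i j ω ≠ 0) : sampleMean X a t i j ω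
    = μ i j + armSum (pullEvent a i j) (centredReward X μ i j) t ω / userCount a t i j ω := by
  have h' : (userCount a t i j ω : ℝ) ≠ 0 := by exact_mod_cast h
  rw [sampleMean, sum_reward_eq X a μ]
  field_simp
  ring

theorem groupFreq_nonneg : 0 ≤ groupFreq a t j ω := by
  unfold groupFreq; positivity

theorem groupFreq_le_one : groupFreq a t j ω ≤ 1 := by
  unfold groupFreq
  refine div_le_one_of_le₀ ?_ (by positivity)
  exact Finset.single_le_sum (f := fun l => (groupCount a t l ω : ℝ))
    (fun _ _ => by positivity) (Finset.mem_univ j)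

/-- Summed over the pulls of an option, a function of the number of earlier pulls runs through its
values at `0, 1, 2, …` once. -/
theorem sum_pulls_eq (f : ℕ → ℝ) :
    ∑ m ∈ Finset.range t, (pullEvent a i j m).indicator (fun ω => f (userCount a m i j ω)) ω
      = ∑ k ∈ Finset.range (userCount a t i j ω), f k := by
  induction t with
  | zero => simp [userCount]
  | succ t ih =>
    rw [Finset.sum_range_succ, ih, userCount_succ]
    by_cases h : j ∈ a (t + 1) i ω <;> simp [pullEvent, h, Finset.sum_range_succ]

/-- The event that the sample mean of option `j`, which is about to be pulled, is too high by `δ`. -/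
def highEvent (δ : ℝ) : Set Ω :=
  {ω | ω ∈ pullEvent a i j t ∧ δ * armCount (pullEvent a i j) t ω ≤
    armSum (pullEvent a i j) (centredReward X μ i j) t ω}

/-- The event that the mean of option `j` lies above its confidence interval. -/
def lowEvent : Set Ω :=
  {ω | 0 < armCount (pullEvent a i j) t ω ∧
    armSum (pullEvent a i j) (centredReward X μ i j) t ω
      ≤ -√(2 * armCount (pullEvent a i j) t ω * Real.log t)}

variable {X a μ i j t ω}

/-- The slack `g / 10` is `g / 20` for the overestimate of `j` plus `g / 20` for the penalty of `l`;
the penalty of `j` only lowers its index. The noise of `l` is offset by its own radius. -/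
theorem le_pullCost_of_index_le {α g : ℝ} (hα : 0 ≤ α) {l : Fin N} {T : ℕ} (htT : t ≤ T)
    (ht : α * √(Real.log t / t) ≤ g / 20) (hg : 0 < g) (hgap : g ≤ μ i l - μ i j)
    (hD : μ i l - μ i j ≤ 1) (hpull : j ∈ a (t + 1) i ω)
    (hidx : upartIndex α X a t i l ω ≤ upartIndex α X a t i j ω)
    (hhigh : ω ∉ highEvent X a μ i j t (g / 20)) (hlow : ω ∉ lowEvent X a μ i l t) :
    μ i l - μ i j ≤ pullCost (Real.log T) g (userCount a t i j ω) := by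
  by_cases hj0 : userCount a t i j ω = 0
  · rw [pullCost, if_pos hj0]; exact hD
  -- An untried `l` has index `⊤`, which the finite index of `j` cannot match.
  by_cases hl0 : userCount a t i l ω = 0
  · rw [upartIndex, upartIndex, if_pos hl0, if_neg hj0] at hidx
    exact absurd hidx (not_le.2 (EReal.coe_lt_top _))
  rw [upartIndex, upartIndex, if_neg hl0, if_neg hj0, EReal.coe_le_coe_iff,
    sampleMean_eq X a μ i l t ω hl0, sampleMean_eq X a μ i j t ω hj0] at hidx
  have hjp : (0 : ℝ) < userCount a t i j ω := by positivity
  have hlp : (0 : ℝ) < userCount a t i l ω := by positivity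
  have hhigh' : armSum (pullEvent a i j) (centredReward X μ i j) t ω / userCount a t i j ω
      ≤ g / 20 := by
    rw [div_le_iff₀ hjp, ← armCount_pullEvent]
    by_contra! hc
    exact hhigh ⟨hpull, hc.le⟩
  have hlow' : 0 ≤ armSum (pullEvent a i l) (centredReward X μ i l) t ω / userCount a t i l ω
      + √(2 * Real.log t / userCount a t i l ω) := by
    have h1 : -√(2 * userCount a t i l ω * Real.log t)
        ≤ armSum (pullEvent a i l) (centredReward X μ i l) t ω := by
      by_contra! hc
      refine hlow ⟨?_, ?_⟩
      · rw [armCount_pullEvent]; exact hlp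
      · rw [armCount_pullEvent]; exact hc.le
    have h2 : √(2 * Real.log t / userCount a t i l ω)
        = √(2 * userCount a t i l ω * Real.log t) / userCount a t i l ω := by
      have e : 2 * Real.log t / userCount a t i l ω
          = 2 * userCount a t i l ω * Real.log t / (userCount a t i l ω : ℝ) ^ 2 := by field_simp
      rw [e, Real.sqrt_div' _ (by positivity), Real.sqrt_sq hlp.le]
    rw [h2, ← add_div]
    exact div_nonneg (by linarith) hlp.le
  have hq : 0 ≤ √(Real.log t / t) := Real.sqrt_nonneg _
  have hβl : α * (1 - groupFreq a t l ω) * √(Real.log t / t) ≤ g / 20 := by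
    refine le_trans (mul_le_mul_of_nonneg_right ?_ hq) ht
    nlinarith [mul_nonneg hα (groupFreq_nonneg a l t ω)]
  have hβj : 0 ≤ α * (1 - groupFreq a t j ω) * √(Real.log t / t) :=
    mul_nonneg (mul_nonneg hα (by linarith [groupFreq_le_one a j t ω])) hq
  refine le_pullCost hg hgap hj0 ?_
  have hlog : √(2 * Real.log t / userCount a t i j ω) ≤ √(2 * Real.log T / userCount a t i j ω) := by
    rcases Nat.eq_zero_or_pos t with rfl | htpos
    · refine Real.sqrt_le_sqrt ?_
      simp only [Nat.cast_zero, Real.log_zero, mul_zero, zero_div]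
      have := Real.log_natCast_nonneg T
      positivity
    · have : (0 : ℝ) < t := by exact_mod_cast htpos
      gcongr
  linarith

end Counts

/-! ### From pathwise regret to expected regret -/

section Regret

variable {M N K : ℕ} {Ω : Type*}

/-- The regret of user `i` on the outcome `ω`, with rewards replaced by their means, is controlled
by the pulls of suboptimal options and by the failures of the confidence bounds. -/
theorem sum_meanRegret_le {X : ℕ → Fin M → Fin N → Ω → ℝ} {a : ℕ → Fin M → Ω → Finset (Fin N)}
    {μ : Fin M → Fin N → ℝ} {α : ℝ} {i : Fin M} {ω : Ω} (hK : 1 ≤ K) (hKN : K ≤ N)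
    (hinj : Function.Injective (μ i)) (hmem : ∀ j, μ i j ∈ Set.Icc (0 : ℝ) 1) (hα : 0 ≤ α)
    (hcard : ∀ t, (a (t + 1) i ω).card = K)
    (hidx : ∀ t, ∀ j ∈ a (t + 1) i ω, ∀ l ∉ a (t + 1) i ω,
      upartIndex α X a t i l ω ≤ upartIndex α X a t i j ω)
    {t₀ : Fin N → ℕ}
    (ht₀ : ∀ j ∉ topOptions K (μ i), ∀ t, t₀ j ≤ t →
      α * √(Real.log t / t) ≤ gap K (μ i) j / 20) (T : ℕ) :
    ∑ t ∈ Finset.range T, (∑ j ∈ topOptions K (μ i), μ i j - ∑ j ∈ a (t + 1) i ω, μ i j)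
      ≤ ∑ j ∈ (topOptions K (μ i))ᶜ, (1 + 400 / 81 * Real.log T / gap K (μ i) j + t₀ j
        + ∑ t ∈ Finset.range T, (highEvent X a μ i j t (gap K (μ i) j / 20)).indicator 1 ω
        + ∑ l, ∑ t ∈ Finset.range T, (lowEvent X a μ i l t).indicator 1 ω) := by
  classical
  set top := topOptions K (μ i) with htop
  set L := Real.log T with hL
  have hL0 : 0 ≤ L := Real.log_natCast_nonneg T
  set early : Fin N → ℕ → ℝ := fun j t => if t < t₀ j then 1 else 0
  set high : Fin N → ℕ → ℝ := fun j t =>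
    (highEvent X a μ i j t (gap K (μ i) j / 20)).indicator 1 ω with hhigh
  set low : Fin N → ℕ → ℝ := fun l t => (lowEvent X a μ i l t).indicator 1 ω with hlow
  set cost : Fin N → ℕ → ℝ := fun j t => pullCost L (gap K (μ i) j) (userCount a t i j ω)
  have hearly0 : ∀ j t, 0 ≤ early j t := fun j t => by
    simp only [early]; split_ifs <;> norm_num
  have hhigh0 : ∀ j t, 0 ≤ high j t := fun j t =>
    Set.indicator_nonneg (fun _ _ => zero_le_one) ω
  have hlow0 : ∀ j t, 0 ≤ low j t := fun j t =>
    Set.indicator_nonneg (fun _ _ => zero_le_one) ω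
  have hcost0 : ∀ j t, 0 ≤ cost j t := fun j t => pullCost_nonneg _ _ _
  have hlowle : ∀ l t, low l t ≤ ∑ l, low l t := fun l t =>
    Finset.single_le_sum (f := fun l => low l t) (fun l _ => hlow0 l t) (Finset.mem_univ l)
  have hstep : ∀ t ∈ Finset.range T, ∑ j ∈ top, μ i j - ∑ j ∈ a (t + 1) i ω, μ i j
      ≤ ∑ j ∈ topᶜ, ((pullEvent a i j t).indicator
        (fun ω => pullCost L (gap K (μ i) j) (userCount a t i j ω)) ω
          + early j t + high j t + ∑ l, low l t) := by
    intro t ht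
    have hswap : ∀ j ∈ a (t + 1) i ω \ top, ∀ l ∈ top \ a (t + 1) i ω,
        μ i l - μ i j ≤ cost j t + early j t + high j t + ∑ l, low l t := by
      intro j hj l hl
      rw [Finset.mem_sdiff] at hj hl
      have hD : μ i l - μ i j ≤ 1 := by linarith [(hmem l).2, (hmem j).1]
      have hs := hlowle l t
      have hll := hlow0 l t
      -- In each exceptional case one indicator equals 1 and already covers `D ≤ 1`.
      by_cases h1 : t < t₀ j
      · have : early j t = 1 := if_pos h1
        linarith [hhigh0 j t, hcost0 j t]
      by_cases h2 : ω ∈ highEvent X a μ i j t (gap K (μ i) j / 20)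
      · have : high j t = 1 := Set.indicator_of_mem h2 _
        linarith [hearly0 j t, hcost0 j t]
      by_cases h3 : ω ∈ lowEvent X a μ i l t
      · have : low l t = 1 := Set.indicator_of_mem h3 _
        linarith [hearly0 j t, hcost0 j t, hhigh0 j t]
      have := le_pullCost_of_index_le hα (Finset.mem_range.1 ht).le (ht₀ j hj.2 t (not_lt.1 h1))
        (gap_pos hinj hK hKN hj.2) (gap_le hl.1) hD hj.1 (hidx t j hj.1 l hl.2) h2 h3
      linarith [hearly0 j t, hhigh0 j t]
    refine (sum_sub_sum_le_of_swap ?_ _ _ hswap).trans ?_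
    · rw [hcard, htop, card_topOptions hinj hKN]
    have hsum0 : ∀ t, 0 ≤ ∑ l, low l t := fun t => Finset.sum_nonneg fun l _ => hlow0 l t
    have heq : ∀ j ∈ a (t + 1) i ω \ top, cost j t + early j t + high j t + ∑ l, low l t
        = (pullEvent a i j t).indicator
          (fun ω => pullCost L (gap K (μ i) j) (userCount a t i j ω)) ω
          + early j t + high j t + ∑ l, low l t := by
      intro j hj
      have : ω ∈ pullEvent a i j t := (Finset.mem_sdiff.1 hj).1
      rw [Set.indicator_of_mem this]
    rw [Finset.sum_congr rfl heq]
    -- The sum is enlarged to all suboptimal options; the indicator keeps the pull cost charged only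
    -- at actual pulls.
    refine Finset.sum_le_sum_of_subset_of_nonneg ?_ fun j _ _ => ?_
    · intro j hj; simpa using (Finset.mem_sdiff.1 hj).2
    · have : 0 ≤ (pullEvent a i j t).indicator
          (fun ω => pullCost L (gap K (μ i) j) (userCount a t i j ω)) ω :=
        Set.indicator_nonneg (fun _ _ => pullCost_nonneg _ _ _) ω
      linarith [hearly0 j t, hhigh0 j t, hsum0 t]
  refine (Finset.sum_le_sum hstep).trans ?_
  rw [Finset.sum_comm]
  refine Finset.sum_le_sum fun j hj => ?_
  simp only [Finset.sum_add_distrib]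
  rw [Finset.sum_comm (s := Finset.univ), sum_pulls_eq]
  have h1 : ∑ k ∈ Finset.range (userCount a T i j ω), pullCost L (gap K (μ i) j) k
      ≤ 1 + 400 / 81 * L / gap K (μ i) j :=
    sum_pullCost_le hL0 (gap_pos hinj hK hKN (Finset.mem_compl.1 hj)) _
  have h2 : ∑ t ∈ Finset.range T, early j t ≤ t₀ j := by
    simp only [early, ← Finset.sum_filter, Finset.sum_const, nsmul_eq_mul, mul_one]
    have : ((Finset.range T).filter (· < t₀ j)).card ≤ (Finset.range (t₀ j)).card :=
      Finset.card_le_card fun t ht => Finset.mem_range.2 (Finset.mem_filter.1 ht).2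
    rw [Finset.card_range] at this
    exact_mod_cast this
  linarith

theorem sum_choice_eq (a : ℕ → Fin M → Ω → Finset (Fin N)) (i : Fin M) (t : ℕ)
    (f : Fin N → Ω → ℝ) (ω : Ω) :
    ∑ j ∈ a (t + 1) i ω, f j ω = ∑ j, (pullEvent a i j t).indicator (f j) ω := by
  classical
  simp only [pullEvent, Set.indicator_apply, Set.mem_ofPred_eq]
  rw [← Finset.sum_filter]
  simp

variable [mΩ : MeasurableSpace Ω] {P : Measure Ω} {ℱ : Filtration ℕ mΩ}
  {μ : Fin M → Fin N → ℝ} {X : ℕ → Fin M → Fin N → Ω → ℝ} {a : ℕ → Fin M → Ω → Finset (Fin N)}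
  {α : ℝ}

theorem IsRewardProcess.measurable (hX : IsRewardProcess P ℱ μ X) (t : ℕ) (i : Fin M) (j : Fin N) :
    Measurable (X (t + 1) i j) :=
  (hX.adapted (t + 1) (by omega) i j).mono (ℱ.le _) le_rfl

theorem IsRewardProcess.indep_comap (hX : IsRewardProcess P ℱ μ X) (t : ℕ) (i : Fin M)
    (j : Fin N) : Indep (MeasurableSpace.comap (X (t + 1) i j) inferInstance) (ℱ t) P := by
  refine indep_of_indep_of_le_left (hX.indep_past t) ?_
  have h1 : Measurable[MeasurableSpace.comap
      (fun ω (i : Fin M) (j : Fin N) => X (t + 1) i j ω) inferInstance] (X (t + 1) i j) :=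
    (measurable_pi_apply (X := fun _ : Fin N => ℝ) j).comp
      ((measurable_pi_apply (X := fun _ : Fin M => Fin N → ℝ) i).comp (comap_measurable _))
  exact h1.comap_le

/-- An event known before the step is independent of the reward of the step. -/
theorem IsRewardProcess.integral_indicator (hX : IsRewardProcess P ℱ μ X)
    (t : ℕ) (i : Fin M) (j : Fin N) {B : Set Ω} (hB : MeasurableSet[ℱ t] B) :
    ∫ ω, B.indicator (X (t + 1) i j) ω ∂P = ∫ ω, B.indicator (fun _ => μ i j) ω ∂P := by
  have hBm : MeasurableSet B := ℱ.le t _ hB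
  have hind : IndepFun (B.indicator (fun _ => (1 : ℝ))) (X (t + 1) i j) P := by
    rw [IndepFun_iff_Indep]
    refine (indep_of_indep_of_le_right (hX.indep_comap t i j) ?_).symm
    exact (Measurable.indicator measurable_const hB).comap_le
  have h1 : ∀ f : Ω → ℝ, B.indicator f = fun ω => B.indicator (fun _ => (1 : ℝ)) ω * f ω := by
    intro f; funext ω
    by_cases h : ω ∈ B <;> simp [h]
  rw [h1 (X (t + 1) i j), hind.integral_fun_mul_eq_mul_integral
    (measurable_const.indicator hBm).aestronglyMeasurable
    (hX.measurable t i j).aestronglyMeasurable, hX.mean (t + 1) (by omega), h1 fun _ => μ i j,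
    integral_mul_const]

variable [IsProbabilityMeasure P]

theorem IsRewardProcess.integrable (hX : IsRewardProcess P ℱ μ X) (t : ℕ) (i : Fin M) (j : Fin N) :
    Integrable (X (t + 1) i j) P := by
  refine Integrable.of_mem_Icc 0 1 (hX.measurable t i j).aemeasurable ?_
  exact hX.mem_unit (t + 1) (by omega) i j

theorem IsRewardProcess.mean_mem (hX : IsRewardProcess P ℱ μ X) (i : Fin M) (j : Fin N) :
    μ i j ∈ Set.Icc (0 : ℝ) 1 := by
  rw [← hX.mean 1 le_rfl i j]
  have h := hX.mem_unit 1 le_rfl i j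
  refine ⟨integral_nonneg_of_ae (h.mono fun ω hω => hω.1), ?_⟩
  have := integral_mono_ae (hX.integrable 0 i j) (integrable_const (1 : ℝ))
    (h.mono fun ω hω => hω.2)
  simpa using this

theorem IsRewardProcess.isArm (hX : IsRewardProcess P ℱ μ X) (ha : IsUPart ℱ K α X a)
    (i : Fin M) (j : Fin N) : IsArm P ℱ (pullEvent a i j) (centredReward X μ i j) where
  pull t := ha.predictable t i j
  adapted t := (hX.adapted (t + 1) (by omega) i j).sub_const _
  indep t := by
    refine indep_of_indep_of_le_left (hX.indep_comap t i j) ?_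
    have : Measurable[MeasurableSpace.comap (X (t + 1) i j) inferInstance]
        (centredReward X μ i j t) := (comap_measurable (X (t + 1) i j)).sub_const _
    exact this.comap_le
  subgaussian t := by
    -- Hoeffding's lemma: a variable in an interval of length 1 has variance proxy `(1/2)² = 1/4`.
    have h := hasSubgaussianMGF_of_mem_Icc (hX.measurable t i j).aemeasurable
      (hX.mem_unit (t + 1) (by omega) i j)
    rw [hX.mean (t + 1) (by omega) i j] at h
    have hc : (‖(1 : ℝ) - 0‖₊ / 2) ^ 2 = 1 / 4 := by
      ext; norm_num
    rwa [hc] at h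

/-- The weak regret is the expectation of the regret in terms of the mean rewards. -/
theorem weakRegret_eq (hX : IsRewardProcess P ℱ μ X) (ha : IsUPart ℱ K α X a) (i : Fin M) (T : ℕ) :
    Integrable (fun ω => ∑ t ∈ Finset.range T,
      (∑ j ∈ topOptions K (μ i), μ i j - ∑ j ∈ a (t + 1) i ω, μ i j)) P ∧
    weakRegret P K μ X a i T = ∫ ω, ∑ t ∈ Finset.range T,
      (∑ j ∈ topOptions K (μ i), μ i j - ∑ j ∈ a (t + 1) i ω, μ i j) ∂P := by
  have hBm : ∀ j t, MeasurableSet (pullEvent a i j t) := fun j t =>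
    ℱ.le t _ (ha.predictable t i j)
  have hint1 : ∀ t j, Integrable ((pullEvent a i j t).indicator (fun _ => μ i j)) P := fun t j =>
    (integrable_const _).indicator (hBm j t)
  have hint2 : ∀ t j, Integrable ((pullEvent a i j t).indicator (X (t + 1) i j)) P := fun t j =>
    (hX.integrable t i j).indicator (hBm j t)
  have e1 : ∀ t ω, ∑ j ∈ a (t + 1) i ω, μ i j
      = ∑ j, (pullEvent a i j t).indicator (fun _ => μ i j) ω := fun t ω =>
    sum_choice_eq a i t (fun j _ => μ i j) ω
  have e2 : ∀ ω, ∑ t ∈ Finset.Icc 1 T, ∑ j ∈ a t i ω, X t i j ω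
      = ∑ t ∈ Finset.range T, ∑ j, (pullEvent a i j t).indicator (X (t + 1) i j) ω := by
    intro ω
    rw [Finset.range_eq_Ico, ← Finset.Ico_add_one_right_eq_Icc,
      ← Finset.sum_Ico_add' (fun t => ∑ j ∈ a t i ω, X t i j ω) 0 T 1]
    exact Finset.sum_congr rfl fun t _ => sum_choice_eq a i t (fun j => X (t + 1) i j) ω
  have hint3 : ∀ t, Integrable
      (fun ω => ∑ j, (pullEvent a i j t).indicator (fun _ => μ i j) ω) P := fun t =>
    integrable_finsetSum _ fun j _ => hint1 t j
  have hint4 : ∀ t, Integrable (fun ω => ∑ j ∈ topOptions K (μ i), μ i j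
      - ∑ j, (pullEvent a i j t).indicator (fun _ => μ i j) ω) P := fun t =>
    (integrable_const _).sub (hint3 t)
  simp only [weakRegret, e1, e2]
  refine ⟨integrable_finsetSum _ fun t _ => hint4 t, ?_⟩
  rw [integral_finsetSum _ fun t _ => integrable_finsetSum _ fun j _ => hint2 t j,
    integral_finsetSum _ fun t _ => hint4 t]
  have e3 : ∀ t, ∫ ω, (∑ j ∈ topOptions K (μ i), μ i j
      - ∑ j, (pullEvent a i j t).indicator (fun _ => μ i j) ω) ∂P
      = ∑ j ∈ topOptions K (μ i), μ i j
        - ∫ ω, ∑ j, (pullEvent a i j t).indicator (X (t + 1) i j) ω ∂P := by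
    intro t
    rw [integral_sub (integrable_const _) (hint3 t), integral_const,
      integral_finsetSum _ fun j _ => hint1 t j, integral_finsetSum _ fun j _ => hint2 t j,
      Finset.sum_congr rfl fun j _ => hX.integral_indicator t i j (B := pullEvent a i j t)
        (ha.predictable t i j)]
    simp
  rw [Finset.sum_congr rfl fun t _ => e3 t, Finset.sum_sub_distrib]
  simp

/-- The part of the regret caused by option `j` which does not grow with time. -/
def armConst (K : ℕ) (m : Fin N → ℝ) (j : Fin N) (t₀ : ℕ) : ℝ :=
  1 + t₀ + 1 / (1 - Real.exp (-2 * (gap K m j / 20) ^ 2)) + N * ∑' t : ℕ, 1 / (t : ℝ) ^ 3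

theorem weakRegret_le (hK : 1 ≤ K) (hKN : K ≤ N) (hα : 0 ≤ α) (hX : IsRewardProcess P ℱ μ X)
    (ha : IsUPart ℱ K α X a) {i : Fin M} (hinj : Function.Injective (μ i)) {t₀ : Fin N → ℕ}
    (ht₀ : ∀ j ∉ topOptions K (μ i), ∀ t, t₀ j ≤ t →
      α * √(Real.log t / t) ≤ gap K (μ i) j / 20) (T : ℕ) :
    weakRegret P K μ X a i T ≤ ∑ j ∈ (topOptions K (μ i))ᶜ,
      (400 / 81 * Real.log T / gap K (μ i) j + armConst K (μ i) j (t₀ j)) := by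
  obtain ⟨hint, heq⟩ := weakRegret_eq hX ha i T
  have harm : ∀ j, IsArm P ℱ (pullEvent a i j) (centredReward X μ i j) := fun j => hX.isArm ha i j
  have hSm : ∀ j t, Measurable (armSum (pullEvent a i j) (centredReward X μ i j) t) := fun j t =>
    ((harm j).measurable_armSum t).mono (ℱ.le t) le_rfl
  have hNm : ∀ j t, Measurable (armCount (pullEvent a i j) t) := fun j t =>
    ((harm j).measurable_armCount t).mono (ℱ.le t) le_rfl
  have hhm : ∀ j t δ, MeasurableSet (highEvent X a μ i j t δ) := fun j t δ =>
    (ℱ.le t _ (ha.predictable t i j)).inter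
      (measurableSet_le ((hNm j t).const_mul δ) (hSm j t))
  have hlm : ∀ j t, MeasurableSet (lowEvent X a μ i j t) := fun j t =>
    (measurableSet_lt measurable_const (hNm j t)).inter
      (measurableSet_le (hSm j t) (((hNm j t).const_mul 2).mul_const _).sqrt.neg)
  have hih : ∀ j t δ, Integrable ((highEvent X a μ i j t δ).indicator (1 : Ω → ℝ)) P :=
    fun j t δ => (integrable_const 1).indicator (hhm j t δ)
  have hil : ∀ j t, Integrable ((lowEvent X a μ i j t).indicator (1 : Ω → ℝ)) P :=
    fun j t => (integrable_const 1).indicator (hlm j t)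
  have hihs : ∀ j δ, Integrable (fun ω => ∑ t ∈ Finset.range T,
      (highEvent X a μ i j t δ).indicator (1 : Ω → ℝ) ω) P := fun j δ =>
    integrable_finsetSum _ fun t _ => hih j t δ
  have hils : ∀ l, Integrable (fun ω => ∑ t ∈ Finset.range T,
      (lowEvent X a μ i l t).indicator (1 : Ω → ℝ) ω) P := fun l =>
    integrable_finsetSum _ fun t _ => hil l t
  have hilss : Integrable (fun ω => ∑ l, ∑ t ∈ Finset.range T,
      (lowEvent X a μ i l t).indicator (1 : Ω → ℝ) ω) P :=
    integrable_finsetSum _ fun l _ => hils l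
  have hj1 : ∀ j, Integrable (fun ω => 1 + 400 / 81 * Real.log T / gap K (μ i) j + t₀ j
      + ∑ t ∈ Finset.range T,
        (highEvent X a μ i j t (gap K (μ i) j / 20)).indicator (1 : Ω → ℝ) ω) P := fun j =>
    (integrable_const _).add (hihs j _)
  rw [heq]
  refine (integral_mono hint (integrable_finsetSum _ fun j _ => (hj1 j).add hilss) fun ω =>
    sum_meanRegret_le hK hKN hinj (hX.mean_mem i) hα (fun t => ha.card_eq t i ω)
      (fun t => ha.highest t i ω) ht₀ T).trans ?_
  rw [integral_finsetSum _ fun j _ => (hj1 j).add hilss]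
  refine Finset.sum_le_sum fun j hj => ?_
  rw [integral_add' (hj1 j) hilss, integral_add (integrable_const _) (hihs j _), integral_const,
    integral_finsetSum _ fun t _ => hih j t _, integral_finsetSum _ fun l _ => hils l]
  have hg : 0 < gap K (μ i) j := gap_pos hinj hK hKN (Finset.mem_compl.1 hj)
  have h1 : ∑ t ∈ Finset.range T,
      ∫ ω, (highEvent X a μ i j t (gap K (μ i) j / 20)).indicator (1 : Ω → ℝ) ω ∂P
      ≤ 1 / (1 - Real.exp (-2 * (gap K (μ i) j / 20) ^ 2)) := by
    simp only [integral_indicator_one (hhm _ _ _)]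
    exact (harm j).sum_prob_upper_deviation (by positivity) T
  have h2 : ∑ l, ∫ ω, ∑ t ∈ Finset.range T, (lowEvent X a μ i l t).indicator (1 : Ω → ℝ) ω ∂P
      ≤ N * ∑' t : ℕ, 1 / (t : ℝ) ^ 3 := by
    have hl : ∀ l ∈ Finset.univ,
        ∫ ω, ∑ t ∈ Finset.range T, (lowEvent X a μ i l t).indicator (1 : Ω → ℝ) ω ∂P
          ≤ ∑' t : ℕ, 1 / (t : ℝ) ^ 3 := by
      intro l _
      rw [integral_finsetSum _ fun t _ => hil l t]
      simp only [integral_indicator_one (hlm _ _)]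
      exact (Finset.sum_le_sum fun t _ => (harm l).prob_lower_radius).trans
        ((Real.summable_one_div_nat_pow.2 (by norm_num)).sum_le_tsum _ fun t _ => by positivity)
    refine (Finset.sum_le_sum hl).trans (le_of_eq ?_)
    simp
  simp only [probReal_univ, one_smul, armConst]
  linarith

theorem exists_penalty_le (α : ℝ) {δ : ℝ} (hδ : 0 < δ) :
    ∃ t₀ : ℕ, ∀ t : ℕ, t₀ ≤ t → α * √(Real.log t / t) ≤ δ := by
  have h1 : Filter.Tendsto (fun x : ℝ => Real.log x / x) Filter.atTop (nhds 0) :=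
    Real.isLittleO_log_id_atTop.tendsto_div_nhds_zero
  have h2 : Filter.Tendsto (fun t : ℕ => α * √(Real.log t / t)) Filter.atTop (nhds 0) := by
    have := ((Real.continuous_sqrt.tendsto 0).comp
      (h1.comp tendsto_natCast_atTop_atTop)).const_mul α
    simpa using this
  exact Filter.eventually_atTop.1 (h2.eventually_le_const hδ)

end Regret

end

end GroupLearning

theorem mainTheorem2 {M N K : ℕ} (hK : 1 ≤ K) (hKN : K ≤ N)
    (μ : Fin M → Fin N → ℝ) (hμ : GroupLearning.UniformPreference μ)
    (α : ℝ) (hα : 0 ≤ α) (ε : ℝ) (hε : 0 < ε) :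
    ∃ C : ℝ, ∀ {Ω : Type*} [mΩ : MeasurableSpace Ω] (P : Measure Ω) [IsProbabilityMeasure P]
      (ℱ : Filtration ℕ mΩ) (X : ℕ → Fin M → Fin N → Ω → ℝ)
      (a : ℕ → Fin M → Ω → Finset (Fin N)),
      GroupLearning.IsRewardProcess P ℱ μ X → GroupLearning.IsUPart ℱ K α X a →
      ∀ (i : Fin M) (t : ℕ), 1 ≤ t →
        GroupLearning.weakRegret P K μ X a i t ≤
          (∑ j ∈ (GroupLearning.topOptions K (μ i))ᶜ,
            (⌈(6 + ε) * Real.log t / GroupLearning.gap K (μ i) j⌉ : ℝ)) + C := by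
  open GroupLearning in
  have hex : ∀ i j, ∃ t₀ : ℕ, j ∉ topOptions K (μ i) → ∀ t : ℕ, t₀ ≤ t →
      α * √(Real.log t / t) ≤ gap K (μ i) j / 20 := by
    intro i j
    by_cases hj : j ∈ topOptions K (μ i)
    · exact ⟨0, fun h => absurd hj h⟩
    · have hg := gap_pos (hμ.distinct i) hK hKN hj
      obtain ⟨t₀, h⟩ := exists_penalty_le α (δ := gap K (μ i) j / 20) (by positivity)
      exact ⟨t₀, fun _ => h⟩
  choose t₀ ht₀ using hex
  -- Summing over all users makes the constant uniform in `i`; it is fixed before the probability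
  -- space.
  refine ⟨∑ i, ∑ j ∈ (GroupLearning.topOptions K (μ i))ᶜ,
    GroupLearning.armConst K (μ i) j (t₀ i j), ?_⟩
  intro Ω mΩ P _ ℱ X a hX ha i t ht
  refine (GroupLearning.weakRegret_le hK hKN hα hX ha (hμ.distinct i) (ht₀ i) t).trans ?_
  rw [Finset.sum_add_distrib]
  refine add_le_add (Finset.sum_le_sum fun j hj => ?_) ?_
  · have hg := GroupLearning.gap_pos (hμ.distinct i) hK hKN (Finset.mem_compl.1 hj)
    refine le_trans ?_ (Int.le_ceil _)
    have hlog : 0 ≤ Real.log t := Real.log_natCast_nonneg t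
    -- What remains is `400/81 ≤ 6 + ε`.
    gcongr
    linarith
  · refine Finset.single_le_sum (f := fun i => ∑ j ∈ (GroupLearning.topOptions K (μ i))ᶜ,
      GroupLearning.armConst K (μ i) j (t₀ i j)) (fun k _ => Finset.sum_nonneg fun j hj => ?_)
      (Finset.mem_univ i)
    have h1 : Real.exp (-2 * (GroupLearning.gap K (μ k) j / 20) ^ 2) ≤ 1 := by
      rw [Real.exp_le_one_iff]
      nlinarith [sq_nonneg (GroupLearning.gap K (μ k) j / 20)]
    have h2 : 0 ≤ 1 / (1 - Real.exp (-2 * (GroupLearning.gap K (μ k) j / 20) ^ 2)) :=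
      div_nonneg zero_le_one (by linarith)
    have h3 : 0 ≤ ∑' t : ℕ, 1 / (t : ℝ) ^ 3 := tsum_nonneg fun t => by positivity
    unfold GroupLearning.armConst
    positivity
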